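/- For a permutation $\pi=\pi_1\cdots\pi_n$ of $[n]=\{1,\dots,n\}$, call the letter $\pi_i$ a cyclic peak if $i<\pi_i>\pi_{\pi_i}$, a cyclic double ascent if $i<\pi_i<\pi_{\pi_i}$, and a cyclic double descent if $i>\pi_i>\pi_{\pi_i}$. Let $\mathrm{cpk}(\pi)$ be the number of cyclic peaks of $\pi$, and let $\mathrm{cdbl}(\pi)$ be the number of cyclic double ascents plus the number of cyclic double descents of $\pi$. Let $\mathfrak{D}_n$ be the set of derangements of $[n]$ (permutations without fixed points), and put $$D^{(\mathrm{cpk},\mathrm{cdbl})}(s,t;x)=1+\sum_{n=1}^{\infty}\Bigl(\sum_{\pi\in\mathfrak{D}_n}s^{\mathrm{cpk}(\pi)}t^{\mathrm{cdbl}(\pi)}\Bigr)\frac{x^n}{n!}.$$ Let the polynomials $U_n(s,t)$ be defined by $U_0(s,t)=1$, $U_1(s,t)=2t$ and $U_n(s,t)=2t\,U_{n-1}(s,t)-s\,U_{n-2}(s,t)$ for $n\ge 2$, and put $$V(s,t;x)=\sum_{n=0}^{\infty}U_n(s,t)\frac{x^{n+2}}{(n+2)!}.$$ Then, as formal power series in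 $x$ with coefficients in $\mathbb{Q}[s,t]$, the series $1-sV(s,t;x)$ is invertible and $$D^{(\mathrm{cpk},\mathrm{cdbl})}(s,t;x)=\frac{1}{1-sV(s,t;x)}.$$ -/

import Mathlib

namespace CyclicDerangements

open Equiv

/-- Number of cyclic peaks of `π`: letters `π i` with `i < π i > π (π i)`. Letters are counted through
their positions `i`. -/
def cpk {n : ℕ} (π : Perm (Fin n)) : ℕ :=
  (Finset.univ.filter fun i : Fin n => i < π i ∧ π i > π (π i)).card

/-- Number of cyclic double ascents of `π`: letters `π i` with `i < π i < π (π i)`. -/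
def cdasc {n : ℕ} (π : Perm (Fin n)) : ℕ :=
  (Finset.univ.filter fun i : Fin n => i < π i ∧ π i < π (π i)).card

/-- Number of cyclic double descents of `π`: letters `π i` with `i > π i > π (π i)`. -/
def cddes {n : ℕ} (π : Perm (Fin n)) : ℕ :=
  (Finset.univ.filter fun i : Fin n => i > π i ∧ π i > π (π i)).card

/-- Total number of cyclic double ascents and cyclic double descents of `π`. -/
def cdbl {n : ℕ} (π : Perm (Fin n)) : ℕ := cdasc π + cddes π

/-- The polynomial ring `ℚ[s, t]`. -/
abbrev Poly : Type := MvPolynomial (Fin 2) ℚ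

/-- The variable `s`. -/
noncomputable def s : Poly := MvPolynomial.X 0

/-- The variable `t`. -/
noncomputable def t : Poly := MvPolynomial.X 1

/-- The two-parameter Chebyshev polynomials of the second kind `U_n(s, t)`. -/
noncomputable def chebU : ℕ → Poly
  | 0 => 1
  | 1 => 2 * t
  | n + 2 => 2 * t * chebU (n + 1) - s * chebU n

/-- `V(s, t; x) = ∑_{n ≥ 0} U_n(s, t) x ^ (n + 2) / (n + 2)!`, a formal power series in `x`. -/
noncomputable def V : PowerSeries Poly :=
  PowerSeries.mk fun
    | 0 => 0
    | 1 => 0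
    | n + 2 => (1 / (Nat.factorial (n + 2) : ℚ)) • chebU n

/-- `D_n(s, t) = ∑ s ^ cpk(π) t ^ cdbl(π)`, over the derangements `π` of `n` letters. -/
noncomputable def derangementPoly (n : ℕ) : Poly :=
  ∑ π : derangements (Fin n), s ^ cpk (π : Perm (Fin n)) * t ^ cdbl (π : Perm (Fin n))

/-- `D(s, t; x) = 1 + ∑_{n ≥ 1} D_n(s, t) x ^ n / n!`, a formal power series in `x`. -/
noncomputable def derangementEgf : PowerSeries Poly :=
  1 + PowerSeries.mk fun
    | 0 => 0
    | n + 1 => (1 / (Nat.factorial (n + 1) : ℚ)) • derangementPoly (n + 1)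

end CyclicDerangements

namespace CyclicDerangements

open Equiv

/-! Mark fixed points by `f` and build permutations by inserting a new largest letter. As a fixed
point it contributes `f`; inside a cycle it becomes a peak and alters one old letter, so the total
effect is a derivation `δ` with `s ↦ 2ts`, `t ↦ s`, `f ↦ s` (`sum_permWeight_insertMax_some`). Hence
the generating function `P` of all permutations satisfies `(d/dx - δ) P = f P`. Since `δ U_{n+1} =
(n+2) s U_n`, the series `G = 1 - sV` satisfies `(d/dx - δ) G = -xs G` (`flowDer_denom`). So `PG`
and `exp(fx)` solve the same equation with constant term 1, which determines the solution. Setting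
`f = 0` in `PG = exp(fx)` leaves the derangements. -/

/-- The polynomial ring `ℚ[s, t, f]`, where `f` marks fixed points. -/
abbrev FixPoly : Type := MvPolynomial (Fin 3) ℚ

/-- The variable marking cyclic peaks. -/
noncomputable def peakVar : FixPoly := MvPolynomial.X 0

/-- The variable marking cyclic double ascents and double descents. -/
noncomputable def dblVar : FixPoly := MvPolynomial.X 1

/-- The variable marking fixed points. -/
noncomputable def fixVar : FixPoly := MvPolynomial.X 2

/-- The derivation of `ℚ[s, t, f]` describing the insertion of a new largest letter into a
permutation: `s ↦ 2ts`, `t ↦ s`, `f ↦ s`. -/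
noncomputable def insertDer : Derivation ℚ FixPoly FixPoly :=
  MvPolynomial.mkDerivation ℚ ![2 * dblVar * peakVar, peakVar, peakVar]

@[simp] theorem insertDer_peakVar : insertDer peakVar = 2 * dblVar * peakVar := by
  simp [insertDer, peakVar]

@[simp] theorem insertDer_dblVar : insertDer dblVar = peakVar := by
  simp [insertDer, dblVar]

@[simp] theorem insertDer_fixVar : insertDer fixVar = peakVar := by
  simp [insertDer, fixVar]

theorem derivation_prod {R A ι : Type*} [CommRing R] [CommRing A] [Algebra R A] [DecidableEq ι]
    (D : Derivation R A A) (u : Finset ι) (g : ι → A) :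
    D (∏ i ∈ u, g i) = ∑ i ∈ u, D (g i) * ∏ j ∈ u.erase i, g j := by
  induction u using Finset.induction_on with
  | empty => simp
  | insert a u ha ih =>
    rw [Finset.prod_insert ha, Derivation.leibniz, ih, Finset.sum_insert ha,
      Finset.erase_insert ha, smul_eq_mul, smul_eq_mul, mul_comm (∏ i ∈ u, g i), add_comm,
      Finset.mul_sum]
    congr 1
    refine Finset.sum_congr rfl fun i hi => ?_
    have hne : a ≠ i := fun h => ha (h ▸ hi)
    rw [Finset.erase_insert_of_ne hne, Finset.prod_insert (by simp [ha])]
    ring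

/-! ### Weights of permutations and insertion of the largest letter -/

/-- The weight of a letter `b` with preimage `a` and image `c`. -/
noncomputable def letterWeight {α : Type*} [LinearOrder α] (a b c : α) : FixPoly :=
  if a < b then (if c < b then peakVar else dblVar)
  else if b < a then (if c < b then dblVar else 1)
  else fixVar

/-- The product of the weights of all letters of a permutation. -/
noncomputable def permWeight {n : ℕ} (σ : Perm (Fin n)) : FixPoly :=
  ∏ j, letterWeight (σ.symm j) j (σ j)

/-- The permutations of `n + 1` letters arise by inserting the largest letter just before `k` in its
cycle, or as a fixed point. -/
def insertMax (n : ℕ) : Option (Fin n) × Perm (Fin n) ≃ Perm (Fin (n + 1)) :=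
  Equiv.Perm.decomposeOption.symm.trans finSuccEquivLast.symm.permCongr

section insertMax

variable {n : ℕ} (k j : Fin n) (σ : Perm (Fin n))

@[simp] theorem insertMax_none_last : insertMax n (none, σ) (Fin.last n) = Fin.last n := by
  simp [insertMax, Equiv.Perm.decomposeOption, Equiv.permCongr_apply]

@[simp] theorem insertMax_none_castSucc :
    insertMax n (none, σ) j.castSucc = (σ j).castSucc := by
  simp [insertMax, Equiv.Perm.decomposeOption, Equiv.permCongr_apply]

@[simp] theorem insertMax_some_last : insertMax n (some k, σ) (Fin.last n) = k.castSucc := by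
  simp [insertMax, Equiv.Perm.decomposeOption, Equiv.permCongr_apply]

@[simp] theorem insertMax_some_castSucc :
    insertMax n (some k, σ) j.castSucc = if σ j = k then Fin.last n else (σ j).castSucc := by
  by_cases h : σ j = k
  · simp [insertMax, Equiv.Perm.decomposeOption, Equiv.permCongr_apply, h]
  · rw [if_neg h]
    simp [insertMax, Equiv.Perm.decomposeOption, Equiv.permCongr_apply]
    rw [Equiv.swap_apply_of_ne_of_ne (by simp) (by simpa using h)]
    simp

@[simp] theorem insertMax_none_symm_last :
    (insertMax n (none, σ)).symm (Fin.last n) = Fin.last n := by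
  simp [Equiv.symm_apply_eq]

@[simp] theorem insertMax_none_symm_castSucc :
    (insertMax n (none, σ)).symm j.castSucc = (σ.symm j).castSucc := by
  simp [Equiv.symm_apply_eq]

@[simp] theorem insertMax_some_symm_last :
    (insertMax n (some k, σ)).symm (Fin.last n) = (σ.symm k).castSucc := by
  simp [Equiv.symm_apply_eq]

@[simp] theorem insertMax_some_symm_castSucc :
    (insertMax n (some k, σ)).symm j.castSucc =
      if j = k then Fin.last n else (σ.symm j).castSucc := by
  rw [Equiv.symm_apply_eq]
  by_cases h : j = k <;> simp [h]

theorem permWeight_insertMax_none :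
    permWeight (insertMax n (none, σ)) = fixVar * permWeight σ := by
  simp [permWeight, Fin.prod_univ_castSucc, letterWeight, mul_comm]

/-- Inserting the largest letter just before `k` changes the weight of one letter: `k` itself if it
ends an ascent or is fixed, and the preimage of `k` otherwise. -/
theorem permWeight_insertMax_some :
    permWeight (insertMax n (some k, σ)) = peakVar *
      (if σ.symm k < k then
        (if σ k < k then dblVar else 1) *
          ∏ j ∈ Finset.univ.erase k, letterWeight (σ.symm j) j (σ j)
      else if k < σ.symm k then
        (if σ.symm (σ.symm k) < σ.symm k then dblVar else 1) *
          ∏ j ∈ Finset.univ.erase (σ.symm k), letterWeight (σ.symm j) j (σ j)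
      else ∏ j ∈ Finset.univ.erase k, letterWeight (σ.symm j) j (σ j)) := by
  have hlast : letterWeight ((insertMax n (some k, σ)).symm (Fin.last n)) (Fin.last n)
      (insertMax n (some k, σ) (Fin.last n)) = peakVar := by
    simp [letterWeight, Fin.castSucc_lt_last]
  rw [permWeight, Fin.prod_univ_castSucc, hlast, mul_comm]
  congr 1
  have key (i : Fin n) (h : ∀ j ≠ i, letterWeight ((insertMax n (some k, σ)).symm j.castSucc)
      j.castSucc (insertMax n (some k, σ) j.castSucc) = letterWeight (σ.symm j) j (σ j)) :
      ∏ j : Fin n, letterWeight ((insertMax n (some k, σ)).symm j.castSucc)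
      j.castSucc (insertMax n (some k, σ) j.castSucc) =
      letterWeight ((insertMax n (some k, σ)).symm i.castSucc) i.castSucc
        (insertMax n (some k, σ) i.castSucc) *
      ∏ j ∈ Finset.univ.erase i, letterWeight (σ.symm j) j (σ j) := by
    rw [← Finset.mul_prod_erase _ _ (Finset.mem_univ i)]
    congr 1
    exact Finset.prod_congr rfl fun j hj => h j (Finset.ne_of_mem_erase hj)
  obtain ⟨p, rfl⟩ := σ.surjective k
  simp only [Equiv.symm_apply_apply, insertMax_some_symm_castSucc, insertMax_some_castSucc,
    EmbeddingLike.apply_eq_iff_eq] at key ⊢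
  have nl (a : Fin n) : ¬ Fin.last n < a.castSucc := not_lt.2 (Fin.le_last _)
  have keep (j : Fin n) (h1 : j ≠ σ p) (h2 : j ≠ p) :
      letterWeight (if j = σ p then Fin.last n else (σ.symm j).castSucc) j.castSucc
        (if j = p then Fin.last n else (σ j).castSucc) = letterWeight (σ.symm j) j (σ j) := by
    simp [h1, h2, letterWeight]
  -- Raising the image of `p` keeps its ascent an ascent, so only the type of `σ p` can change.
  have asc (h1 : p < σ p) (j : Fin n) (hj : j ≠ σ p) :
      letterWeight (if j = σ p then Fin.last n else (σ.symm j).castSucc) j.castSucc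
        (if j = p then Fin.last n else (σ j).castSucc) = letterWeight (σ.symm j) j (σ j) := by
    by_cases hp : j = p
    · subst hp
      simp [letterWeight, hj, nl, h1.not_gt]
    · exact keep j hj hp
  -- Here `σ p` is still entered from above, so only the type of `p` can change.
  have desc (h1 : σ p < p) (j : Fin n) (hj : j ≠ p) :
      letterWeight (if j = σ p then Fin.last n else (σ.symm j).castSucc) j.castSucc
        (if j = p then Fin.last n else (σ j).castSucc) = letterWeight (σ.symm j) j (σ j) := by
    by_cases hp : j = σ p
    · subst hp
      simp [letterWeight, hj, nl, h1.not_gt, h1, Fin.castSucc_lt_last]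
    · exact keep j hp hj
  rcases lt_trichotomy p (σ p) with h1 | h1 | h1
  · rw [key (σ p) (asc h1), if_pos h1]
    simp [letterWeight, h1.ne', nl, Fin.castSucc_lt_last]
  · rw [← h1] at key keep ⊢
    rw [key p fun j hj => keep j hj hj, if_neg (lt_irrefl p), if_neg (lt_irrefl p)]
    simp [letterWeight, nl, Fin.castSucc_lt_last]
  · rw [key p (desc h1), if_neg h1.not_gt, if_pos h1]
    simp only [letterWeight, if_neg h1.ne', if_true, nl, if_false, Fin.castSucc_lt_castSucc_iff]
    by_cases h2 : σ.symm p < p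
    · simp [h2]
    · have h3 : p ≠ σ.symm p := fun h => h1.ne (by simpa using congrArg σ h)
      simp [h2, lt_of_le_of_ne (not_lt.1 h2) h3]

/-- The total weight of the permutations of `n + 1` letters obtained from `σ` by inserting the
largest letter into a cycle of `σ` is the derivative of the weight of `σ`. -/
theorem sum_permWeight_insertMax_some :
    ∑ k, permWeight (insertMax n (some k, σ)) = insertDer (permWeight σ) := by
  simp only [permWeight_insertMax_some, ← Finset.mul_sum]
  let E (j : Fin n) : FixPoly := ∏ i ∈ Finset.univ.erase j, letterWeight (σ.symm i) i (σ i)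
  -- `a` collects insertions just before a letter that ends an ascent, `b` those just after a letter
  -- that starts a descent, `c` those at a fixed point. Reindexing `b` charges each insertion to the
  -- letter it alters: a peak is hit twice, a double ascent, double descent or fixed point once, a
  -- valley never.
  let a (k : Fin n) : FixPoly :=
    if σ.symm k < k then (if σ k < k then dblVar else 1) * E k else 0
  let b (j : Fin n) : FixPoly :=
    if σ j < j then (if σ.symm j < j then dblVar else 1) * E j else 0
  let c (k : Fin n) : FixPoly := if σ.symm k = k then E k else 0
  have hsplit (k : Fin n) :
      (if σ.symm k < k then (if σ k < k then dblVar else 1) * E k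
      else if k < σ.symm k then
        (if σ.symm (σ.symm k) < σ.symm k then dblVar else 1) * E (σ.symm k)
      else E k) = a k + b (σ.symm k) + c k := by
    rcases lt_trichotomy (σ.symm k) k with h | h | h
    · simp [a, b, c, h, h.not_gt, h.ne]
    · simp [a, b, c, h, ((Equiv.symm_apply_eq σ).1 h).symm]
    · simp [a, b, c, h, h.not_gt, h.ne']
  rw [Finset.sum_congr rfl fun k _ => hsplit k, Finset.sum_add_distrib, Finset.sum_add_distrib,
    Equiv.sum_comp σ.symm b, ← Finset.sum_add_distrib, ← Finset.sum_add_distrib, Finset.mul_sum,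
    permWeight, derivation_prod]
  refine Finset.sum_congr rfl fun j _ => ?_
  change peakVar * (a j + b j + c j) = _ * E j
  have hfix : σ.symm j = j ↔ σ j = j := by rw [Equiv.symm_apply_eq, eq_comm]
  rcases lt_trichotomy (σ.symm j) j with h | h | h
  · rcases lt_trichotomy (σ j) j with h' | h' | h'
    · simp [a, b, c, letterWeight, h, h', h.ne]
      ring
    · exact absurd (hfix.2 h') h.ne
    · simp [a, b, c, letterWeight, h, h'.not_gt, h.ne]
  · simp [a, b, c, letterWeight, h, hfix.1 h]
  · rcases lt_trichotomy (σ j) j with h' | h' | h'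
    · simp [a, b, c, letterWeight, h, h.not_gt, h', h.ne']
    · exact absurd (hfix.2 h') h.ne'
    · simp [a, b, c, letterWeight, h, h.not_gt, h'.not_gt, h.ne']

end insertMax

/-- The total weight of the permutations of `n` letters. -/
noncomputable def weightSum (n : ℕ) : FixPoly := ∑ σ : Perm (Fin n), permWeight σ

theorem weightSum_zero : weightSum 0 = 1 := by
  simp [weightSum, permWeight]

theorem weightSum_succ (n : ℕ) :
    weightSum (n + 1) = fixVar * weightSum n + insertDer (weightSum n) := by
  rw [weightSum, ← Equiv.sum_comp (insertMax n), Fintype.sum_prod_type, Fintype.sum_option,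
    Finset.sum_comm]
  simp only [permWeight_insertMax_none, sum_permWeight_insertMax_some, weightSum, map_sum,
    Finset.mul_sum]

/-! ### Specialization to derangements -/

/-- Forget fixed points: `f ↦ 0`. -/
noncomputable def killFix : FixPoly →ₐ[ℚ] Poly := MvPolynomial.aeval ![s, t, 0]

@[simp] theorem killFix_peakVar : killFix peakVar = s := by simp [killFix, peakVar]
@[simp] theorem killFix_dblVar : killFix dblVar = t := by simp [killFix, dblVar]
@[simp] theorem killFix_fixVar : killFix fixVar = 0 := by simp [killFix, fixVar]

/-- The inclusion `ℚ[s, t] → ℚ[s, t, f]`. -/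
noncomputable def toFix : Poly →ₐ[ℚ] FixPoly := MvPolynomial.aeval ![peakVar, dblVar]

@[simp] theorem toFix_s : toFix s = peakVar := by simp [toFix, s]
@[simp] theorem toFix_t : toFix t = dblVar := by simp [toFix, t]

@[simp] theorem killFix_toFix (p : Poly) : killFix (toFix p) = p := by
  have h : killFix.comp toFix = AlgHom.id ℚ Poly := by
    ext i : 1
    fin_cases i
    · simpa [s] using congrArg killFix toFix_s
    · simpa [t] using congrArg killFix toFix_t
  exact DFunLike.congr_fun h p

theorem killFix_permWeight_of_derangement {n : ℕ} {σ : Perm (Fin n)}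
    (hσ : σ ∈ derangements (Fin n)) :
    killFix (permWeight σ) = s ^ cpk σ * t ^ cdbl σ := by
  -- The weight is a product over letters, the statistics count positions; `j = σ i` matches them.
  rw [permWeight, map_prod, ← Equiv.prod_comp σ, cpk, cdbl, cdasc, cddes, pow_add,
    Finset.card_filter, Finset.card_filter, Finset.card_filter, ← Finset.prod_pow_eq_pow_sum,
    ← Finset.prod_pow_eq_pow_sum, ← Finset.prod_pow_eq_pow_sum, ← Finset.prod_mul_distrib,
    ← Finset.prod_mul_distrib]
  refine Finset.prod_congr rfl fun i _ => ?_
  have h1 : σ i ≠ i := hσ i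
  have h2 : σ (σ i) ≠ σ i := hσ (σ i)
  rw [Equiv.symm_apply_apply]
  rcases lt_or_gt_of_ne h1 with h1 | h1 <;> rcases lt_or_gt_of_ne h2 with h2 | h2 <;>
    simp [letterWeight, h1, h2, h1.not_gt, h2.not_gt]

theorem killFix_permWeight_of_notMem {n : ℕ} {σ : Perm (Fin n)}
    (hσ : σ ∉ derangements (Fin n)) : killFix (permWeight σ) = 0 := by
  obtain ⟨i, hi⟩ : ∃ i, σ i = i := by simpa [derangements] using hσ
  have hi' : σ.symm i = i := by rw [Equiv.symm_apply_eq, hi]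
  rw [permWeight, map_prod]
  exact Finset.prod_eq_zero (Finset.mem_univ i) (by simp [letterWeight, hi'])

theorem killFix_weightSum (n : ℕ) : killFix (weightSum n) = derangementPoly n := by
  classical
  rw [weightSum, map_sum, derangementPoly,
    ← Finset.sum_subset (Finset.subset_univ (Finset.univ.filter (· ∈ derangements (Fin n))))
      fun σ _ h => killFix_permWeight_of_notMem (by simpa using h)]
  rw [Finset.sum_subtype (p := fun σ => σ ∈ derangements (Fin n)) _ (by simp)]
  exact Finset.sum_congr rfl fun σ _ => killFix_permWeight_of_derangement σ.2

/-- Apply `δ` to the recurrence: the term from `δ s = 2ts` lowers the coefficient of `2ts U_{n+1}`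
from `n+3` to `n+2`, so the recurrence reassembles `(n+2) s U_{n+2}`, and `δ t = s` adds `2s
U_{n+2}`. -/
theorem insertDer_toFix_chebU_succ (n : ℕ) :
    insertDer (toFix (chebU (n + 1))) = (n + 2) * (peakVar * toFix (chebU n)) := by
  have h2 : insertDer (2 : FixPoly) = 0 := by exact_mod_cast insertDer.map_natCast 2
  have t2 : toFix 2 = 2 := map_ofNat toFix 2
  have e (n : ℕ) : toFix (chebU (n + 2)) = 2 * dblVar * toFix (chebU (n + 1)) -
      peakVar * toFix (chebU n) := by
    rw [chebU, map_sub, map_mul, map_mul, map_mul, t2, toFix_t, toFix_s]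
  have e1 : toFix (chebU 1) = 2 * dblVar := by rw [chebU, map_mul, t2, toFix_t]
  have e0 : toFix (chebU 0) = 1 := by rw [chebU, map_one]
  induction n using Nat.twoStepInduction with
  | zero => simp [e0, e1, h2]
  | one =>
    simp [e, e0, e1, h2]
    ring
  | more n ih1 ih2 =>
    rw [e (n + 1), map_sub, Derivation.leibniz, Derivation.leibniz, Derivation.leibniz, ih1, ih2,
      h2, insertDer_dblVar, insertDer_peakVar, e]
    simp only [smul_eq_mul]
    push_cast
    ring

/-! ### Differential equations for the generating functions -/

/-- Coefficientwise application of a derivation to power series. -/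
noncomputable def coeffDer {A R : Type*} [CommRing A] [CommRing R] [Algebra A R]
    (D : Derivation A R R) : Derivation A (PowerSeries R) (PowerSeries R) :=
  Derivation.mk'
    { toFun := fun F => PowerSeries.mk fun n => D (PowerSeries.coeff n F)
      map_add' := fun F G => by ext n; simp
      map_smul' := fun a F => by ext n; simp }
    fun F G => by
      ext n
      simp only [LinearMap.coe_mk, AddHom.coe_mk, PowerSeries.coeff_mk, PowerSeries.coeff_mul,
        map_sum, Derivation.leibniz, smul_eq_mul, map_add, Finset.sum_add_distrib]
      congr 1
      rw [← Finset.Nat.sum_antidiagonal_swap]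
      rfl

@[simp] theorem coeff_coeffDer {A R : Type*} [CommRing A] [CommRing R] [Algebra A R]
    (D : Derivation A R R) (F : PowerSeries R) (n : ℕ) :
    PowerSeries.coeff n (coeffDer D F) = D (PowerSeries.coeff n F) := by
  simp [coeffDer]

/-- The derivation `d/dx - δ` of `ℚ[s, t, f][[x]]`, with `δ` the coefficientwise `insertDer`. -/
noncomputable def flowDer :
    Derivation ℚ (PowerSeries FixPoly) (PowerSeries FixPoly) :=
  (PowerSeries.derivative FixPoly).restrictScalars ℚ - coeffDer insertDer

theorem coeff_flowDer (F : PowerSeries FixPoly) (n : ℕ) :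
    PowerSeries.coeff n (flowDer F) =
      PowerSeries.coeff (n + 1) F * (n + 1) - insertDer (PowerSeries.coeff n F) := by
  simp [flowDer, PowerSeries.coeff_derivative]

/-- The exponential generating function of all permutations, with fixed points marked. -/
noncomputable def permEgf : PowerSeries FixPoly :=
  PowerSeries.mk fun n => (1 / (n.factorial : ℚ)) • weightSum n

theorem factorial_succ_smul (n : ℕ) (p : FixPoly) :
    (1 / ((n + 1).factorial : ℚ)) • p * (n + 1) = (1 / (n.factorial : ℚ)) • p := by
  have h : ((n : FixPoly) + 1) = ((n + 1 : ℚ)) • (1 : FixPoly) := by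
    rw [← Algebra.algebraMap_eq_smul_one]
    simp
  have hn : (n : ℚ) + 1 ≠ 0 := by positivity
  rw [h, smul_mul_smul_comm, mul_one, Nat.factorial_succ]
  congr 1
  push_cast
  field_simp

theorem flowDer_permEgf : flowDer permEgf = PowerSeries.C fixVar * permEgf := by
  ext1 n
  rw [coeff_flowDer, PowerSeries.coeff_C_mul]
  simp only [permEgf, PowerSeries.coeff_mk]
  rw [factorial_succ_smul, weightSum_succ, Derivation.map_smul, smul_add, add_sub_cancel_right,
    mul_smul_comm]

/-- The series `1 - s V` over `ℚ[s, t, f]`. -/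
noncomputable def denom : PowerSeries FixPoly :=
  1 - PowerSeries.C peakVar * PowerSeries.map (toFix : Poly →+* FixPoly) V

theorem flowDer_map_V :
    flowDer (PowerSeries.map (toFix : Poly →+* FixPoly) V) =
      (2 * PowerSeries.C dblVar - PowerSeries.X * PowerSeries.C peakVar) *
        PowerSeries.map (toFix : Poly →+* FixPoly) V + PowerSeries.X := by
  have c0 : PowerSeries.coeff 0 V = 0 := by simp [V]
  have c1 : PowerSeries.coeff 1 V = 0 := by simp [V]
  have c2 (n : ℕ) : PowerSeries.coeff (n + 2) V =
      (1 / (Nat.factorial (n + 2) : ℚ)) • chebU n := by simp [V]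
  have hX (n : ℕ) (F : PowerSeries FixPoly) : PowerSeries.coeff (n + 1)
      (PowerSeries.X * PowerSeries.C peakVar * F) = peakVar * PowerSeries.coeff n F := by
    rw [mul_assoc, PowerSeries.coeff_succ_X_mul, PowerSeries.coeff_C_mul]
  have h2 : (2 * PowerSeries.C dblVar : PowerSeries FixPoly) = PowerSeries.C (2 * dblVar) := by
    rw [map_mul, map_ofNat]
  have hf (n : ℕ) : toFix (PowerSeries.coeff (n + 2) V) * (n + 1 + 1) =
      (1 / (Nat.factorial (n + 1) : ℚ)) • toFix (chebU n) := by
    rw [c2, map_smul, ← factorial_succ_smul (n + 1)]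
    push_cast
    rfl
  ext1 n
  rw [coeff_flowDer, sub_mul, map_add, map_sub, h2, PowerSeries.coeff_C_mul]
  -- The Chebyshev recurrence yields the coefficients from `n = 3` on; `U_0` at `n = 1` produces the
  -- extra summand `X`.
  match n with
  | 0 => simp [c0, c1]
  | 1 =>
    have := hf 0
    rw [hX]
    simp [chebU, c0, c1] at this ⊢
    exact this
  | 2 =>
    have := hf 1
    have e1 : toFix (chebU 1) = 2 * dblVar := by
      rw [chebU, map_mul, toFix_t]
      exact congrArg (· * dblVar) (map_ofNat toFix 2)
    have e2 : toFix (PowerSeries.coeff 2 V) = (1 / 2 : ℚ) • (1 : FixPoly) := by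
      simp [c2 0, chebU]
    rw [hX]
    simp only [PowerSeries.coeff_map, RingHom.coe_coe, PowerSeries.coeff_X, c1, e2, map_zero]
    push_cast at this ⊢
    rw [e1] at this
    rw [show (2 : FixPoly) + 1 = 1 + 1 + 1 by norm_num, this]
    simp
  | n + 3 =>
    have h3 := hf (n + 2)
    rw [hX]
    have hd := insertDer_toFix_chebU_succ n
    have hU : toFix (chebU (n + 2)) = 2 * dblVar * toFix (chebU (n + 1)) -
        peakVar * toFix (chebU n) := by
      rw [chebU, map_sub, map_mul, map_mul, map_mul, toFix_t, toFix_s]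
      exact congrArg (· * dblVar * _ - _) (map_ofNat toFix 2)
    simp only [PowerSeries.coeff_map, RingHom.coe_coe, PowerSeries.coeff_X]
    rw [if_neg (by lia), add_zero]
    have hc : (((n + 3 : ℕ) : FixPoly) + 1) = ((n + 2 : ℕ) : FixPoly) + 1 + 1 := by
      push_cast; ring
    rw [hc, h3, hU, c2 (n + 1), c2 n, map_smul toFix, map_smul toFix, Derivation.map_smul, hd,
      ← factorial_succ_smul (n + 2)]
    simp only [mul_smul_comm, smul_mul_assoc]
    rw [← smul_sub, ← smul_sub]
    congr 1
    push_cast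
    ring

/-- The contribution of `δ s = 2ts` cancels the `2t` in the equation for `V`, and the inhomogeneous
term `X` supplies the missing 1 of `1 - sV`. -/
theorem flowDer_denom :
    flowDer denom = - (PowerSeries.X * PowerSeries.C peakVar) * denom := by
  have hC : flowDer (PowerSeries.C peakVar) = - (2 * PowerSeries.C dblVar * PowerSeries.C peakVar) := by
    ext1 n
    rw [coeff_flowDer]
    have h2 : (2 * PowerSeries.C dblVar * PowerSeries.C peakVar : PowerSeries FixPoly) =
      PowerSeries.C (2 * dblVar * peakVar) := by
      rw [map_mul, map_mul, map_ofNat]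
    rw [h2]
    cases n <;> simp [PowerSeries.coeff_C]
  rw [denom, map_sub, Derivation.leibniz, flowDer_map_V, hC, Derivation.map_one_eq_zero,
    smul_eq_mul, smul_eq_mul]
  ring

theorem flowDer_permEgf_mul_denom :
    flowDer (permEgf * denom) =
      (PowerSeries.C fixVar - PowerSeries.X * PowerSeries.C peakVar) * (permEgf * denom) := by
  rw [Derivation.leibniz, flowDer_permEgf, flowDer_denom, smul_eq_mul, smul_eq_mul]
  ring

theorem constantCoeff_V : PowerSeries.constantCoeff V = 0 := by
  rw [← PowerSeries.coeff_zero_eq_constantCoeff_apply]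
  simp [V]

/-- The equation expresses each coefficient through the two before it. For `f ^ n / n!`, the term
from `δ f = s` cancels the one from `-xs`. -/
theorem coeff_permEgf_mul_denom (n : ℕ) :
    PowerSeries.coeff n (permEgf * denom) = (1 / (n.factorial : ℚ)) • fixVar ^ n := by
  have h0 : PowerSeries.coeff 0 (permEgf * denom) = 1 := by
    have hV : PowerSeries.constantCoeff (PowerSeries.map (toFix : Poly →+* FixPoly) V) = 0 := by
      rw [← PowerSeries.coeff_zero_eq_constantCoeff_apply, PowerSeries.coeff_map,
        PowerSeries.coeff_zero_eq_constantCoeff_apply, constantCoeff_V, map_zero]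
    rw [PowerSeries.coeff_zero_eq_constantCoeff, map_mul, denom, map_sub, map_mul, hV]
    simp [permEgf, weightSum_zero]
  have step (n : ℕ) (p : FixPoly)
      (h : PowerSeries.coeff n (flowDer (permEgf * denom)) +
        insertDer (PowerSeries.coeff n (permEgf * denom)) = (1 / (n.factorial : ℚ)) • p) :
      PowerSeries.coeff (n + 1) (permEgf * denom) = (1 / ((n + 1).factorial : ℚ)) • p := by
    refine mul_right_cancel₀ (Nat.cast_add_one_ne_zero n : (n : FixPoly) + 1 ≠ 0) ?_
    rw [factorial_succ_smul, ← h, coeff_flowDer, sub_add_cancel]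
  induction n using Nat.twoStepInduction with
  | zero => simpa using h0
  | one =>
    refine step 0 _ ?_
    rw [flowDer_permEgf_mul_denom, sub_mul, map_sub, PowerSeries.coeff_C_mul, h0, mul_assoc,
      PowerSeries.coeff_zero_X_mul]
    simp
  | more n ih1 ih2 =>
    refine step (n + 1) _ ?_
    rw [flowDer_permEgf_mul_denom, sub_mul, map_sub, PowerSeries.coeff_C_mul, mul_assoc,
      PowerSeries.coeff_succ_X_mul, PowerSeries.coeff_C_mul, ih1, ih2, Derivation.map_smul,
      Derivation.leibniz_pow, ← factorial_succ_smul n, insertDer_fixVar]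
    simp only [smul_eq_mul, nsmul_eq_mul, Nat.add_sub_cancel, mul_smul_comm, smul_mul_assoc]
    rw [← smul_sub, ← smul_add]
    congr 1
    push_cast
    ring

theorem map_killFix_permEgf :
    PowerSeries.map (killFix : FixPoly →+* Poly) permEgf = derangementEgf := by
  ext1 n
  cases n with
  | zero => simp [permEgf, derangementEgf, weightSum_zero]
  | succ n => simp [permEgf, derangementEgf, killFix_weightSum, PowerSeries.coeff_one]

theorem map_killFix_denom :
    PowerSeries.map (killFix : FixPoly →+* Poly) denom = 1 - PowerSeries.C s * V := by
  have h : PowerSeries.map (killFix : FixPoly →+* Poly)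
      (PowerSeries.map (toFix : Poly →+* FixPoly) V) = V := by
    ext1 n
    simp
  rw [denom, map_sub, map_mul, h, map_one]
  simp

theorem derangementEgf_mul : derangementEgf * (1 - PowerSeries.C s * V) = 1 := by
  rw [← map_killFix_permEgf, ← map_killFix_denom, ← map_mul]
  ext1 n
  rw [PowerSeries.coeff_map, coeff_permEgf_mul_denom]
  -- At `f = 0` the series `exp(fx)` collapses to 1.
  cases n <;> simp [PowerSeries.coeff_one]

end CyclicDerangements

/-- In `ℚ[s, t][[x]]`, the series `1 - s V` is invertible and `D = 1 / (1 - s V)`. -/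
theorem theorem7 :
    IsUnit (1 - PowerSeries.C CyclicDerangements.s * CyclicDerangements.V) ∧
      CyclicDerangements.derangementEgf =
        Ring.inverse (1 - PowerSeries.C CyclicDerangements.s * CyclicDerangements.V) := by
  have h := CyclicDerangements.derangementEgf_mul
  have hu := IsUnit.of_mul_eq_one_right _ h
  refine ⟨hu, ?_⟩
  rw [← one_mul (Ring.inverse _), Ring.eq_mul_inverse_iff_mul_eq _ _ _ hu, h]
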